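/- **Setting.** Let $N\ge 1$ and consider a system of $N$ qubits. Fix $J,K\in\mathbb N$, real coefficients $c_1,\dots,c_J$, non-empty sets $S_1,\dots,S_K$ of qubits of the system and reals $\ell_1,\dots,\ell_K>0$, and put $$c:=\sum_{j=1}^J|c_j|+\sum_{k=1}^K \ell_k^2 .$$ For density operators $\sigma_1,\dots,\sigma_J$ on the $N$ qubits and operators $L_1,\dots,L_K$, where $L_k$ acts on the qubits in $S_k$ and has Hilbert–Schmidt norm $\|L_k\|_2=\ell_k$ (taken on the space of the qubits in $S_k$), let $$\mathcal L(\rho)=-i[H,\rho]+\sum_{k=1}^K\Big(L_k\rho L_k^\dagger-\tfrac12\{L_k^\dagger L_k,\rho\}\Big),\qquad H=\sum_{j=1}^J c_j\sigma_j ,$$ where $L_k$ is extended by the identity on the other qubits. The Lindblad operator $L_k$ is encoded in the pure program state $|\psi_k\rangle=(L_k\otimes I)|\Gamma\rangle/\|L_k\|_2$ on two copies of the qubits in $S_k$, with $|\Gamma\rangle=\sum_i|i\rangle|i\rangle$; the program states for $H$ are $\sigma_1,\dots,\sigma_J$. A sample-based protocol for time $t\geq 0$ and error $\varepsilon>0$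 consists of numbers $n_1,\dots,n_J,m_1,\dots,m_K\in\mathbb N$ and a quantum channel (completely positive trace-preserving map) $\mathcal P$, which may depend on all the fixed data above and on $t,\varepsilon$ but not on the $\sigma_j$ and $L_k$, such that for all $\sigma_j$ and $L_k$ as above $$\tfrac12\Big\|\mathcal P\circ\mathcal A-e^{\mathcal L t}\Big\|_\diamond\le\varepsilon,\qquad \mathcal A(\rho)=\rho\otimes\bigotimes_j\sigma_j^{\otimes n_j}\otimes\bigotimes_k|\psi_k\rangle\langle\psi_k|^{\otimes m_k}.$$ **Theorem.** There are absolute constants $\kappa>0$ and $a>0$ (independent of $N$, $J$, $K$, the $c_j$, $S_k$, $\ell_k$, and of $t$, $\varepsilon$) such that, whenever $t\ge0$ and $0<\varepsilon\le a\min\{1,ct\}$, every such protocol uses in total at least $$\sum_{j=1}^J n_j+\sum_{k=1}^K m_k\ \ge\ \kappa\,\frac{c^2t^2}{\varepsilon}$$ program states. In particular, any such protocol with Lindblad operators acting on a bounded number of qubits needs $\Omega(c^2t^2/\varepsilon)$ program states. -/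

import Mathlib

open scoped BigOperators ENNReal ComplexOrder Matrix Kronecker

namespace SampleSim

noncomputable section

/-! ### States, norms, channels (finite-dimensional, in coordinates) -/

/-- Density operators: positive semidefinite of trace one. -/
def IsDensity {A : Type*} [Fintype A] (ρ : Matrix A A ℂ) : Prop :=
  ρ.PosSemidef ∧ ρ.trace = 1

/-- The trace norm `‖X‖₁ = Tr[(X X†)^{1/2}]`, the sum of the square roots of the eigenvalues of
`X X†`. -/
def traceNorm {A : Type*} [Fintype A] [DecidableEq A] (X : Matrix A A ℂ) : ℝ :=
  ∑ i, Real.sqrt ((Matrix.isHermitian_mul_conjTranspose_self X).eigenvalues i)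

/-- The Schatten 2-norm `‖X‖₂ = (Tr[X X†])^{1/2}`. -/
def hsNorm {A : Type*} [Fintype A] (X : Matrix A A ℂ) : ℝ :=
  Real.sqrt ((X * Xᴴ).trace.re)

/-- `id_R ⊗ Φ` on matrices over `R × A`: the map `Φ` is applied to every `A`-block. -/
def amplify {A B : Type*} (R : Type*) (Φ : Matrix A A ℂ →ₗ[ℂ] Matrix B B ℂ)
    (X : Matrix (R × A) (R × A) ℂ) : Matrix (R × B) (R × B) ℂ :=
  fun p q => Φ (fun a a' => X (p.1, a) (q.1, a')) p.2 q.2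

/-- Quantum channels: completely positive and trace-preserving maps. -/
def IsChannel {A B : Type*} [Fintype A] [Fintype B]
    (Φ : Matrix A A ℂ →ₗ[ℂ] Matrix B B ℂ) : Prop :=
  (∀ (r : ℕ) (X : Matrix (Fin r × A) (Fin r × A) ℂ), X.PosSemidef →
      (amplify (Fin r) Φ X).PosSemidef) ∧
    ∀ X : Matrix A A ℂ, (Φ X).trace = X.trace

/-- The diamond norm: supremum of `‖(id_R ⊗ Φ)(ρ)‖₁` over all finite-dimensional reference
systems `R` and all states `ρ` of `R ⊗ A`. It takes values in `[0, ∞]`. -/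
def diamondNorm {A B : Type*} [Fintype A] [Fintype B] [DecidableEq B]
    (Φ : Matrix A A ℂ →ₗ[ℂ] Matrix B B ℂ) : ℝ≥0∞ :=
  ⨆ (r : ℕ) (ρ : Matrix (Fin r × A) (Fin r × A) ℂ) (_ : IsDensity ρ),
    ENNReal.ofReal (traceNorm (amplify (Fin r) Φ ρ))

/-- Tensor product of a finite family of matrices. -/
def tensorFamily {ι : Type*} [Fintype ι] {X : ι → Type*}
    (M : ∀ i, Matrix (X i) (X i) ℂ) : Matrix (∀ i, X i) (∀ i, X i) ℂ :=
  fun x y => ∏ i, M i (x i) (y i)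

/-- The map `ζ ↦ ζ ⊗ ω` that appends `ω`. -/
def append {A B : Type*} (ω : Matrix B B ℂ) : Matrix A A ℂ →ₗ[ℂ] Matrix (A × B) (A × B) ℂ where
  toFun ζ := ζ ⊗ₖ ω
  map_add' ζ η := Matrix.add_kronecker ζ η ω
  map_smul' z ζ := Matrix.smul_kronecker z ζ ω

/-! ### Lindbladians -/

/-- `ρ ↦ -i[H, ρ] + ∑ₖ (Lₖ ρ Lₖ† - ½ {Lₖ† Lₖ, ρ})`. -/
def lindbladian {A : Type*} [Fintype A] {K : ℕ} (H : Matrix A A ℂ) (L : Fin K → Matrix A A ℂ) :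
    Matrix A A ℂ →ₗ[ℂ] Matrix A A ℂ where
  toFun ρ := (-Complex.I) • (H * ρ - ρ * H) +
    ∑ k, (L k * ρ * (L k)ᴴ - (1 / 2 : ℂ) • ((L k)ᴴ * L k * ρ + ρ * ((L k)ᴴ * L k)))
  map_add' ρ τ := by
    simp only [Matrix.mul_add, Matrix.add_mul, smul_sub, smul_add, Finset.sum_sub_distrib,
      Finset.sum_add_distrib]
    abel
  map_smul' z ρ := by
    simp only [Matrix.mul_smul, Matrix.smul_mul, RingHom.id_apply, smul_add, smul_sub,
      Finset.smul_sum, smul_comm z]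

/-- Convergence of the exponential series of a linear map in a finite-dimensional normed space. -/
theorem expSeries_apply_summable {E : Type*} [NormedAddCommGroup E] [NormedSpace ℂ E]
    [FiniteDimensional ℂ E] (f : E →ₗ[ℂ] E) (t : ℝ) (x : E) :
    Summable fun k : ℕ => ((t : ℂ) ^ k / (k.factorial : ℂ)) • (f ^ k) x := by
  have : CompleteSpace E := FiniteDimensional.complete ℂ E
  let T : E →L[ℂ] E := LinearMap.toContinuousLinearMap f
  have hT : ∀ k : ℕ, ∀ y, (T ^ k) y = (f ^ k) y := by
    intro k
    induction k with
    | zero => intro y; simp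
    | succ k ih =>
      intro y
      rw [pow_succ, pow_succ]
      exact ih (f y)
  have h := (NormedSpace.expSeries_summable' (𝕂 := ℂ) ((t : ℂ) • T)).map
    (ContinuousLinearMap.apply ℂ E x) (ContinuousLinearMap.apply ℂ E x).continuous
  refine h.congr fun k => ?_
  simp only [Function.comp_apply, ContinuousLinearMap.apply_apply, smul_pow,
    smul_apply, hT, smul_smul]
  congr 1
  rw [div_eq_inv_mul]

/-- The series `∑ₖ (tᵏ / k!) 𝓛ᵏ(ρ)` converges. -/
theorem evolution_summable {A : Type*} [Finite A]
    (𝓛 : Matrix A A ℂ →ₗ[ℂ] Matrix A A ℂ) (t : ℝ) (ρ : Matrix A A ℂ) :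
    Summable fun k : ℕ => ((t : ℂ) ^ k / (k.factorial : ℂ)) • (𝓛 ^ k) ρ := by
  have := Fintype.ofFinite A
  let _ : NormedAddCommGroup (Matrix A A ℂ) := Matrix.normedAddCommGroup
  let _ : NormedSpace ℂ (Matrix A A ℂ) := Matrix.normedSpace
  exact expSeries_apply_summable 𝓛 t ρ

/-- The evolution `e^{𝓛t}(ρ) = ∑ₖ 𝓛ᵏ(ρ) tᵏ / k!`. -/
def evolution {A : Type*} [Finite A] (𝓛 : Matrix A A ℂ →ₗ[ℂ] Matrix A A ℂ) (t : ℝ) :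
    Matrix A A ℂ →ₗ[ℂ] Matrix A A ℂ where
  toFun ρ := ∑' k : ℕ, ((t : ℂ) ^ k / (k.factorial : ℂ)) • (𝓛 ^ k) ρ
  map_add' ρ τ := by
    rw [← (evolution_summable 𝓛 t ρ).tsum_add (evolution_summable 𝓛 t τ)]
    simp only [map_add, smul_add]
  map_smul' z ρ := by
    rw [RingHom.id_apply, ← (evolution_summable 𝓛 t ρ).tsum_const_smul z]
    simp only [map_smul, smul_comm z]

/-! ### Qubits and program states -/

/-- Computational basis labels of a register of qubits indexed by `I`. -/
abbrev Bits (I : Type*) : Type _ := I → Fin 2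

/-- The operator on `N` qubits that acts as `L` on the qubits in `S` and as the identity on the
other qubits. -/
def embedLocal {N : ℕ} (S : Finset (Fin N)) (L : Matrix (Bits S) (Bits S) ℂ) :
    Matrix (Bits (Fin N)) (Bits (Fin N)) ℂ :=
  fun x y => if ∀ i, i ∉ S → x i = y i then L (fun i => x i) (fun i => y i) else 0

/-- The unnormalized maximally entangled vector `|Γ⟩ = ∑ⱼ |j⟩ ⊗ |j⟩`. -/
def gammaVec (A : Type*) [DecidableEq A] : A × A → ℂ :=
  fun p => if p.1 = p.2 then 1 else 0

/-- The vector `|ψ_L⟩ = (L ⊗ I)|Γ⟩ / ‖L‖₂`. -/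
def psiVec {A : Type*} [Fintype A] [DecidableEq A] (L : Matrix A A ℂ) : A × A → ℂ :=
  ((hsNorm L : ℂ)⁻¹) • ((L ⊗ₖ (1 : Matrix A A ℂ)) *ᵥ gammaVec A)

/-- The program state `|ψ_L⟩⟨ψ_L|`. -/
def psiState {A : Type*} [Fintype A] [DecidableEq A] (L : Matrix A A ℂ) :
    Matrix (A × A) (A × A) ℂ :=
  Matrix.vecMulVec (psiVec L) (star (psiVec L))

/-- Basis labels of the program register holding `n j` copies of the `j`-th Hamiltonian program
state (a state of all `N` qubits) and `m k` copies of the `k`-th Lindblad program state (a state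
of two copies of the qubits in `S k`). -/
abbrev ProgramIdx {N J K : ℕ} (S : Fin K → Finset (Fin N)) (n : Fin J → ℕ) (m : Fin K → ℕ) :
    Type :=
  (((p : Σ j : Fin J, Fin (n j)) → Bits (Fin N)) ×
    ((p : Σ k : Fin K, Fin (m k)) → Bits (S p.1) × Bits (S p.1)))

/-- The joint state `⨂ⱼ σⱼ^{⊗ n j} ⊗ ⨂ₖ ψₖ^{⊗ m k}` of all the program copies. -/
def programState {N J K : ℕ} {S : Fin K → Finset (Fin N)} (n : Fin J → ℕ) (m : Fin K → ℕ)
    (σ : Fin J → Matrix (Bits (Fin N)) (Bits (Fin N)) ℂ)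
    (L : ∀ k, Matrix (Bits (S k)) (Bits (S k)) ℂ) :
    Matrix (ProgramIdx S n m) (ProgramIdx S n m) ℂ :=
  tensorFamily (fun p : Σ j : Fin J, Fin (n j) => σ p.1) ⊗ₖ
    tensorFamily (fun p : Σ k : Fin K, Fin (m k) => psiState (L p.1))

/-- The Lindbladian on `N` qubits with Hamiltonian `∑ⱼ cⱼ σⱼ` and Lindblad operators `Lₖ`, the
`k`-th one acting on the qubits in `S k`. -/
def targetLindbladian {N J K : ℕ} {S : Fin K → Finset (Fin N)} (c : Fin J → ℝ)
    (σ : Fin J → Matrix (Bits (Fin N)) (Bits (Fin N)) ℂ)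
    (L : ∀ k, Matrix (Bits (S k)) (Bits (S k)) ℂ) :
    Matrix (Bits (Fin N)) (Bits (Fin N)) ℂ →ₗ[ℂ] Matrix (Bits (Fin N)) (Bits (Fin N)) ℂ :=
  lindbladian (∑ j, (c j : ℂ) • σ j) (fun k => embedLocal (S k) (L k))

/-- The map `P`, applied to the system together with `n j` copies of each `σⱼ` and `m k` copies
of each `|ψₖ⟩`, simulates `e^{𝓛t}` up to normalized diamond distance `ε`, whatever the states
`σⱼ` and the Lindblad operators `Lₖ` on the qubits in `S k` with `‖Lₖ‖₂ = ℓ k` are. -/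
def Simulates {N J K : ℕ} (c : Fin J → ℝ) (S : Fin K → Finset (Fin N)) (ℓ : Fin K → ℝ)
    (t ε : ℝ) (n : Fin J → ℕ) (m : Fin K → ℕ)
    (P : Matrix (Bits (Fin N) × ProgramIdx S n m) (Bits (Fin N) × ProgramIdx S n m) ℂ →ₗ[ℂ]
      Matrix (Bits (Fin N)) (Bits (Fin N)) ℂ) : Prop :=
  ∀ (σ : Fin J → Matrix (Bits (Fin N)) (Bits (Fin N)) ℂ)
    (L : ∀ k, Matrix (Bits (S k)) (Bits (S k)) ℂ),
    (∀ j, IsDensity (σ j)) → (∀ k, hsNorm (L k) = ℓ k) →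
      diamondNorm (P ∘ₗ append (programState n m σ L) -
          evolution (targetLindbladian c σ L) t) / 2 ≤ ENNReal.ofReal ε

end

end SampleSim

namespace SampleSim

noncomputable section

/-! ### Differences of positive semidefinite matrices -/

/-! The argument amplifies a protocol for time t into a long simulation, then uses that simulation
to discriminate two nearby instances. Repeating the protocol k ≈ 1/ε times on the same system, with
fresh program states each time, simulates time T = kt. The errors add up to order kε, which the
choice of k keeps below a small constant (`decompBound_iterate`, `norm_iterate_sub_le`).

The instances are diagonal, supported on the bit strings 00…0 and 11…1, and indexed by an angle φ.
The coherence between these strings acquires a phase at rate B sin φ, with B = ∑|c_j| + ½∑ℓ_k² ≥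
c/2, while its damping rate is only of order φ² (`angleRate_zero_one`). Comparing φ with −φ at φ =
1/(BT), the ideal coherences at time T differ by a constant. Yet each program copy, whether for the
Hamiltonian or for a Lindblad operator, contributes the same overlap factor cos φ between the two
instances (`trace_block_angleBlock`). With M copies per run, the total overlap is cos φ ^ (Mk) ≥ 1 −
Mkφ²/2. A constant difference of outputs therefore forces Mk ≳ φ⁻² = (BT)², that is, M ≳ B²t²k ≈
c²t²/ε.

Overlaps are tracked without fidelities: the two alternatives are the diagonal blocks of one
positive semidefinite matrix over `Fin 2 × A`, and the overlap is the trace of its off-diagonal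
block. A channel applied blockwise preserves positivity, by complete positivity with a
two-dimensional reference, and preserves this trace (`exists_block_iterate`). A large overlap makes
the diagonal blocks close (`norm_diagBlock_sub_le`). `DecompBound` stands in for a trace-norm bound,
because its triangle inequality and its contraction under positive trace-preserving maps are
immediate. -/

/-- `X` is a difference of two positive semidefinite matrices of total trace at most `r`. -/
def DecompBound {A : Type*} [Fintype A] (X : Matrix A A ℂ) (r : ℝ) : Prop :=
  ∃ Y Z : Matrix A A ℂ, Y.PosSemidef ∧ Z.PosSemidef ∧ X = Y - Z ∧ Y.trace.re + Z.trace.re ≤ r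

theorem DecompBound.add {A : Type*} [Fintype A] {X X' : Matrix A A ℂ} {r r' : ℝ}
    (h : DecompBound X r) (h' : DecompBound X' r') : DecompBound (X + X') (r + r') := by
  obtain ⟨Y, Z, hY, hZ, rfl, hr⟩ := h
  obtain ⟨Y', Z', hY', hZ', rfl, hr'⟩ := h'
  refine ⟨Y + Y', Z + Z', hY.add hY', hZ.add hZ', by abel, ?_⟩
  simp only [Matrix.trace_add, Complex.add_re]
  linarith

theorem DecompBound.zero {A : Type*} [Fintype A] : DecompBound (0 : Matrix A A ℂ) 0 :=
  ⟨0, 0, Matrix.PosSemidef.zero, Matrix.PosSemidef.zero, by simp, by simp⟩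

theorem DecompBound.mono {A : Type*} [Fintype A] {X : Matrix A A ℂ} {r r' : ℝ}
    (h : DecompBound X r) (hr : r ≤ r') : DecompBound X r' := by
  obtain ⟨Y, Z, hY, hZ, rfl, hs⟩ := h
  exact ⟨Y, Z, hY, hZ, rfl, hs.trans hr⟩

theorem DecompBound.map {A B : Type*} [Fintype A] [Fintype B] {X : Matrix A A ℂ} {r : ℝ}
    (h : DecompBound X r) (Φ : Matrix A A ℂ →ₗ[ℂ] Matrix B B ℂ)
    (hpos : ∀ Y, Y.PosSemidef → (Φ Y).PosSemidef) (htr : ∀ Y, (Φ Y).trace = Y.trace) :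
    DecompBound (Φ X) r := by
  obtain ⟨Y, Z, hY, hZ, rfl, hr⟩ := h
  exact ⟨Φ Y, Φ Z, hpos Y hY, hpos Z hZ, map_sub .., by rwa [htr, htr]⟩

theorem DecompBound.submatrix_equiv {A B : Type*} [Fintype A] [Fintype B] {X : Matrix A A ℂ}
    {r : ℝ} (h : DecompBound X r) (e : B ≃ A) : DecompBound (X.submatrix e e) r := by
  obtain ⟨Y, Z, hY, hZ, rfl, hr⟩ := h
  refine ⟨Y.submatrix e e, Z.submatrix e e, hY.submatrix e, hZ.submatrix e, rfl, ?_⟩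
  have key : ∀ W : Matrix A A ℂ, (W.submatrix e e).trace = W.trace := fun W =>
    Equiv.sum_comp e fun i => W i i
  rwa [key, key]

theorem re_mul_star_self (z : ℂ) : (z * star z).re = ‖z‖ ^ 2 := by
  rw [← starRingEnd_apply, Complex.mul_conj, Complex.ofReal_re, Complex.normSq_eq_norm_sq]

/-- The entries of a positive semidefinite matrix are bounded by its trace. -/
theorem norm_entry_le_trace {A : Type*} [Fintype A] {Y : Matrix A A ℂ}
    (hY : Y.PosSemidef) (x y : A) : ‖Y x y‖ ≤ Y.trace.re := by
  classical
  obtain ⟨m, v, rfl⟩ := Matrix.posSemidef_iff_eq_sum_vecMulVec.mp hY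
  have hd : ∀ z, ∑ i, ‖v i z‖ ^ 2 ≤
      (∑ i, Matrix.vecMulVec (v i) (star (v i))).trace.re := by
    intro z
    rw [Matrix.trace_sum, Complex.re_sum]
    refine Finset.sum_le_sum fun i _ => ?_
    rw [Matrix.trace, Complex.re_sum]
    have : ∀ w, (Matrix.diag (Matrix.vecMulVec (v i) (star (v i))) w).re = ‖v i w‖ ^ 2 :=
      fun w => re_mul_star_self (v i w)
    simp_rw [this]
    exact Finset.single_le_sum (f := fun w => ‖v i w‖ ^ 2) (fun _ _ => by positivity)
      (Finset.mem_univ z)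
  set τ := (∑ i, Matrix.vecMulVec (v i) (star (v i))).trace.re
  have h1 : ‖(∑ i, Matrix.vecMulVec (v i) (star (v i))) x y‖ ≤ ∑ i, ‖v i x‖ * ‖v i y‖ := by
    rw [Matrix.sum_apply]
    refine (norm_sum_le _ _).trans (le_of_eq ?_)
    refine Finset.sum_congr rfl fun i _ => ?_
    simp [Matrix.vecMulVec_apply]
  have h2 : ∑ i, ‖v i x‖ * ‖v i y‖ ≤ ∑ i, (‖v i x‖ ^ 2 + ‖v i y‖ ^ 2) / 2 :=
    Finset.sum_le_sum fun i _ => by nlinarith [sq_nonneg (‖v i x‖ - ‖v i y‖)]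
  rw [← Finset.sum_div, Finset.sum_add_distrib] at h2
  linarith [hd x, hd y]

theorem DecompBound.norm_entry_le {A : Type*} [Fintype A] {X : Matrix A A ℂ} {r : ℝ}
    (h : DecompBound X r) (x y : A) : ‖X x y‖ ≤ r := by
  obtain ⟨Y, Z, hY, hZ, rfl, hr⟩ := h
  calc ‖(Y - Z) x y‖ ≤ ‖Y x y‖ + ‖Z x y‖ := norm_sub_le _ _
    _ ≤ _ := (add_le_add (norm_entry_le_trace hY x y) (norm_entry_le_trace hZ x y)).trans hr

/-- The trace norm of a Hermitian matrix is the sum of the absolute values of its eigenvalues. -/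
theorem traceNorm_eq_sum_abs_eigenvalues {A : Type*} [Fintype A] [DecidableEq A]
    {X : Matrix A A ℂ} (hX : X.IsHermitian) : traceNorm X = ∑ i, |hX.eigenvalues i| := by
  -- The eigenvalues of X X† and the squared eigenvalues of X are matched as multisets, as roots of
  -- one characteristic polynomial; no index-by-index matching is needed.
  have hsq : X * Xᴴ = cfc (fun x : ℝ => x ^ 2) X := by
    have hsa : IsSelfAdjoint X := hX
    rw [hX.eq, cfc_pow_id (R := ℝ) X 2, sq]
  have h1 := (Matrix.isHermitian_mul_conjTranspose_self X).charpoly_eq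
  conv_lhs at h1 => rw [hsq, hX.charpoly_cfc_eq]
  have h2 := congrArg Polynomial.roots h1
  rw [Polynomial.roots_prod _ _ (Finset.prod_ne_zero_iff.mpr fun i _ =>
      Polynomial.X_sub_C_ne_zero _),
    Polynomial.roots_prod _ _ (Finset.prod_ne_zero_iff.mpr fun i _ =>
      Polynomial.X_sub_C_ne_zero _)] at h2
  simp only [Polynomial.roots_X_sub_C, Multiset.bind_singleton] at h2
  have h3 := congrArg (fun s : Multiset ℂ => (s.map fun z => √z.re).sum) h2
  simp only [Multiset.map_map, Function.comp_def, Complex.coe_algebraMap,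
    Complex.ofReal_re, Real.sqrt_sq_eq_abs] at h3
  exact h3.symm

/-- Jordan decomposition: the positive and negative parts, read off in an eigenbasis, have total
trace ∑|λᵢ|. -/
theorem decompBound_traceNorm {A : Type*} [Fintype A] [DecidableEq A]
    {X : Matrix A A ℂ} (hX : X.IsHermitian) : DecompBound X (traceNorm X) := by
  set U : Matrix A A ℂ := (hX.eigenvectorUnitary : Matrix A A ℂ)
  have hU : Uᴴ * U = 1 := Unitary.star_mul_self_of_mem hX.eigenvectorUnitary.2
  have key : ∀ d : A → ℝ, (∀ i, 0 ≤ d i) →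
      (U * Matrix.diagonal (fun i => (d i : ℂ)) * Uᴴ).PosSemidef := fun d hd =>
    (Matrix.PosSemidef.diagonal fun i => by simpa using hd i).mul_mul_conjTranspose_same U
  have tr : ∀ d : A → ℝ,
      (U * Matrix.diagonal (fun i => (d i : ℂ)) * Uᴴ).trace.re = ∑ i, d i := by
    intro d
    rw [Matrix.trace_mul_cycle, hU, one_mul, Matrix.trace_diagonal, ← Complex.ofReal_sum,
      Complex.ofReal_re]
  refine ⟨_, _, key (fun i => max (hX.eigenvalues i) 0) fun i => le_max_right _ _,
    key (fun i => max (-hX.eigenvalues i) 0) fun i => le_max_right _ _, ?_, ?_⟩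
  · rw [← Matrix.sub_mul, ← Matrix.mul_sub, Matrix.diagonal_sub]
    conv_lhs => rw [hX.spectral_theorem, Unitary.conjStarAlgAut_apply]
    congr 3
    ext i
    have hi : hX.eigenvalues i = max (hX.eigenvalues i) 0 - max (-hX.eigenvalues i) 0 := by
      rcases le_total 0 (hX.eigenvalues i) with h | h <;> simp [h]
    exact (congrArg Complex.ofReal hi).trans (Complex.ofReal_sub _ _)
  · rw [tr, tr, traceNorm_eq_sum_abs_eigenvalues hX, ← Finset.sum_add_distrib]
    refine le_of_eq (Finset.sum_congr rfl fun i _ => ?_)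
    rcases le_total 0 (hX.eigenvalues i) with h | h <;> simp [h, abs_of_nonneg, abs_of_nonpos]

/-! ### Closeness from the overlap of purifications -/

/-- If `A` and `B` are the diagonal blocks of a positive semidefinite matrix, both of trace one,
whose off-diagonal block has real trace `f`, then the entries of `A - B` are at most
`2 √(2 - 2f)`. -/
theorem norm_diagBlock_sub_le {A : Type*} [Fintype A]
    {G : Matrix (Fin 2 × A) (Fin 2 × A) ℂ} (hG : G.PosSemidef) {f : ℝ}
    (h0 : ∑ a, (G (0, a) (0, a)).re = 1) (h1 : ∑ a, (G (1, a) (1, a)).re = 1)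
    (h01 : ∑ a, (G (0, a) (1, a)).re = f) (x y : A) :
    ‖G (0, x) (0, y) - G (1, x) (1, y)‖ ≤ 2 * √(2 - 2 * f) := by
  -- For s = 0, 1 the amplitudes v i (s, a) purify the two diagonal blocks, with i labelling the
  -- purifying system. Their squared distance is 1 + 1 − 2f, and Cauchy–Schwarz transfers closeness
  -- to the blocks.
  obtain ⟨m, v, rfl⟩ := Matrix.posSemidef_iff_eq_sum_vecMulVec.mp hG
  have happ : ∀ p q, (∑ i, Matrix.vecMulVec (v i) (star (v i))) p q =
      ∑ i, v i p * star (v i q) := by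
    intro p q
    simp [Matrix.sum_apply, Matrix.vecMulVec_apply]
  simp only [happ, Complex.re_sum] at h0 h1 h01 ⊢
  simp only [re_mul_star_self] at h0 h1
  have hD : ∑ a, ∑ i, ‖v i (0, a) - v i (1, a)‖ ^ 2 = 2 - 2 * f := by
    have : ∀ z w : ℂ, ‖z - w‖ ^ 2 = ‖z‖ ^ 2 + ‖w‖ ^ 2 - 2 * (z * star w).re := by
      intro z w
      simp only [← Complex.normSq_eq_norm_sq, Complex.normSq_sub]
      rfl
    simp only [this, Finset.sum_sub_distrib, Finset.sum_add_distrib, h0, h1, ← Finset.mul_sum, h01]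
    ring
  have single : ∀ (g : A → Fin m → ℝ) (z : A), (∀ a i, 0 ≤ g a i) →
      ∑ i, g z i ≤ ∑ a, ∑ i, g a i := fun g z hg =>
    Finset.single_le_sum (f := fun a => ∑ i, g a i)
      (fun a _ => Finset.sum_nonneg fun i _ => hg a i) (Finset.mem_univ z)
  have hDz : ∀ z, ∑ i, ‖v i (0, z) - v i (1, z)‖ ^ 2 ≤ 2 - 2 * f := fun z =>
    hD ▸ single (fun a i => ‖v i (0, a) - v i (1, a)‖ ^ 2) z fun _ _ => by positivity
  have h0z : ∀ z, ∑ i, ‖v i (0, z)‖ ^ 2 ≤ 1 := fun z =>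
    h0 ▸ single (fun a i => ‖v i (0, a)‖ ^ 2) z fun _ _ => by positivity
  have h1z : ∀ z, ∑ i, ‖v i (1, z)‖ ^ 2 ≤ 1 := fun z =>
    h1 ▸ single (fun a i => ‖v i (1, a)‖ ^ 2) z fun _ _ => by positivity
  have cs : ∀ a b : Fin m → ℂ, ∑ i, ‖a i‖ ^ 2 ≤ 2 - 2 * f → ∑ i, ‖b i‖ ^ 2 ≤ 1 →
      ∑ i, ‖a i‖ * ‖b i‖ ≤ √(2 - 2 * f) := by
    intro a b ha hb
    calc ∑ i, ‖a i‖ * ‖b i‖ ≤ √(∑ i, ‖a i‖ ^ 2) * √(∑ i, ‖b i‖ ^ 2) :=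
          Real.sum_mul_le_sqrt_mul_sqrt _ _ _
      _ ≤ √(2 - 2 * f) * √1 := by gcongr
      _ = _ := by simp
  have hsplit : ∑ i, v i (0, x) * star (v i (0, y)) - ∑ i, v i (1, x) * star (v i (1, y)) =
      ∑ i, ((v i (0, x) - v i (1, x)) * star (v i (0, y)) +
        star (v i (0, y) - v i (1, y)) * v i (1, x)) := by
    rw [← Finset.sum_sub_distrib]
    refine Finset.sum_congr rfl fun i _ => ?_
    rw [star_sub]
    ring
  rw [hsplit]
  calc _ ≤ ∑ i, (‖v i (0, x) - v i (1, x)‖ * ‖v i (0, y)‖ +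
        ‖v i (0, y) - v i (1, y)‖ * ‖v i (1, x)‖) := by
        refine (norm_sum_le _ _).trans (Finset.sum_le_sum fun i _ => ?_)
        refine (norm_add_le _ _).trans (le_of_eq ?_)
        simp only [norm_mul, norm_star]
    _ ≤ √(2 - 2 * f) + √(2 - 2 * f) := by
        rw [Finset.sum_add_distrib]
        exact add_le_add (cs _ _ (hDz x) (h0z y)) (cs _ _ (hDz y) (h1z x))
    _ = _ := by ring


/-! ### Channels -/

theorem IsChannel.map_posSemidef {A B : Type*} [Fintype A] [Fintype B]
    {Φ : Matrix A A ℂ →ₗ[ℂ] Matrix B B ℂ} (hΦ : IsChannel Φ) {X : Matrix A A ℂ}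
    (hX : X.PosSemidef) : (Φ X).PosSemidef :=
  (hΦ.1 1 (X.submatrix Prod.snd Prod.snd) (hX.submatrix _)).submatrix fun b => (0, b)

theorem IsDensity.submatrix_snd {A : Type*} [Fintype A] {ρ : Matrix A A ℂ}
    (hρ : IsDensity ρ) :
    IsDensity (ρ.submatrix Prod.snd Prod.snd : Matrix (Fin 1 × A) (Fin 1 × A) ℂ) := by
  refine ⟨hρ.1.submatrix _, ?_⟩
  rw [← hρ.2]
  exact Equiv.sum_comp (Equiv.uniqueProd A (Fin 1)) fun a => ρ a a

/-- A bound on the diamond norm bounds the images of states. -/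
theorem decompBound_of_diamondNorm_le {A B : Type*} [Fintype A] [Fintype B] [DecidableEq B]
    {Φ : Matrix A A ℂ →ₗ[ℂ] Matrix B B ℂ} {ε : ℝ} (hε : 0 ≤ ε)
    (hΦ : diamondNorm Φ / 2 ≤ ENNReal.ofReal ε) {ρ : Matrix A A ℂ} (hρ : IsDensity ρ)
    (hH : (Φ ρ).IsHermitian) : DecompBound (Φ ρ) (2 * ε) := by
  have h1 : diamondNorm Φ ≤ ENNReal.ofReal (2 * ε) := by
    rw [ENNReal.div_le_iff (by norm_num) (by norm_num)] at hΦ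
    rwa [mul_comm, ENNReal.ofReal_mul hε, ENNReal.ofReal_ofNat]
  -- A one-dimensional reference already suffices: the lower bound never needs entangled inputs.
  set ρ' : Matrix (Fin 1 × A) (Fin 1 × A) ℂ := ρ.submatrix Prod.snd Prod.snd with hρ'
  have h2 : ENNReal.ofReal (traceNorm (amplify (Fin 1) Φ ρ')) ≤ ENNReal.ofReal (2 * ε) := by
    refine le_trans ?_ h1
    unfold diamondNorm
    exact le_iSup₂_of_le 1 ρ' (le_iSup_of_le hρ.submatrix_snd le_rfl)
  have h3 := (ENNReal.ofReal_le_ofReal_iff (by positivity)).mp h2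
  have h4 : amplify (Fin 1) Φ ρ' = (Φ ρ).submatrix Prod.snd Prod.snd := rfl
  have h5 : DecompBound (amplify (Fin 1) Φ ρ') (2 * ε) :=
    (decompBound_traceNorm (by rw [h4]; exact hH.submatrix _)).mono h3
  exact h5.submatrix_equiv (Equiv.uniqueProd B (Fin 1)).symm

/-- If `Φ` is positive and trace preserving and is `r`-close to `E` along the `E`-orbit of `ρ 0`,
then the `k`-fold iterates differ by at most `k r`. -/
theorem decompBound_iterate {A : Type*} [Fintype A] {Φ E : Matrix A A ℂ →ₗ[ℂ] Matrix A A ℂ}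
    (hpos : ∀ Y, Y.PosSemidef → (Φ Y).PosSemidef) (htr : ∀ Y, (Φ Y).trace = Y.trace)
    {ρ : ℕ → Matrix A A ℂ} (hE : ∀ j, E (ρ j) = ρ (j + 1)) {r : ℝ}
    (hstep : ∀ j, DecompBound ((Φ - E) (ρ j)) r) (k : ℕ) :
    DecompBound ((Φ ^ k) (ρ 0) - ρ k) (k * r) := by
  induction k with
  | zero => simpa using DecompBound.zero
  | succ k ih =>
    have h := (ih.map Φ hpos htr).add (hstep k)
    -- Telescoping: the old error is carried through Φ, which does not increase it, and one new
    -- error is made on the exact orbit point ρ k.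
    have e : (Φ ^ (k + 1)) (ρ 0) - ρ (k + 1) =
        Φ ((Φ ^ k) (ρ 0) - ρ k) + (Φ - E) (ρ k) := by
      rw [pow_succ', Module.End.mul_apply, map_sub, LinearMap.sub_apply, hE]
      abel
    rw [e]
    refine h.mono (le_of_eq ?_)
    push_cast
    ring

theorem append_posSemidef {A B : Type*} [Fintype A] [Fintype B] {ω : Matrix B B ℂ}
    (hω : ω.PosSemidef) {ρ : Matrix A A ℂ} (hρ : ρ.PosSemidef) :
    (append ω ρ : Matrix (A × B) (A × B) ℂ).PosSemidef :=
  hρ.kronecker hω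

theorem trace_append {A B : Type*} [Fintype A] [Fintype B] (ω : Matrix B B ℂ) (ρ : Matrix A A ℂ) :
    (append ω ρ : Matrix (A × B) (A × B) ℂ).trace = ρ.trace * ω.trace :=
  Matrix.trace_kronecker ρ ω

/-! ### Joint states of two program states -/

/-- The `(s, t)` block of a matrix over `Fin 2 × A`. -/
def block {A : Type*} (G : Matrix (Fin 2 × A) (Fin 2 × A) ℂ) (s t : Fin 2) : Matrix A A ℂ :=
  fun a b => G (s, a) (t, b)

/-- The block matrix with blocks `G_{st} ⊗ W_{st}`. -/
def blockKronecker {A B : Type*} (G : Matrix (Fin 2 × A) (Fin 2 × A) ℂ)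
    (W : Matrix (Fin 2 × B) (Fin 2 × B) ℂ) : Matrix (Fin 2 × A × B) (Fin 2 × A × B) ℂ :=
  (G.submatrix (fun p => (p.1, p.2.1)) fun p => (p.1, p.2.1)).hadamard
    (W.submatrix (fun p => (p.1, p.2.2)) fun p => (p.1, p.2.2))

/-- Schur product theorem: the blockwise tensor product is a Hadamard product of pulled-back
positive semidefinite matrices. -/
theorem blockKronecker_posSemidef {A B : Type*} {G : Matrix (Fin 2 × A) (Fin 2 × A) ℂ}
    {W : Matrix (Fin 2 × B) (Fin 2 × B) ℂ} (hG : G.PosSemidef) (hW : W.PosSemidef) :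
    (blockKronecker G W).PosSemidef :=
  (hG.submatrix _).hadamard (hW.submatrix _)

theorem block_blockKronecker {A B : Type*} (G : Matrix (Fin 2 × A) (Fin 2 × A) ℂ)
    (W : Matrix (Fin 2 × B) (Fin 2 × B) ℂ) (s t : Fin 2) :
    block (blockKronecker G W) s t = block G s t ⊗ₖ block W s t :=
  rfl

/-- Running a channel repeatedly on fresh program states from one of two families, the joint
block matrix stays positive semidefinite and the overlap of the two families is multiplicative. -/
theorem exists_block_iterate {A B : Type*} [Fintype A] [Fintype B]
    {P : Matrix (A × B) (A × B) ℂ →ₗ[ℂ] Matrix A A ℂ} (hP : IsChannel P)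
    {W : Matrix (Fin 2 × B) (Fin 2 × B) ℂ} (hW : W.PosSemidef) {ρ : Matrix A A ℂ}
    (hρ : IsDensity ρ) (k : ℕ) :
    ∃ G : Matrix (Fin 2 × A) (Fin 2 × A) ℂ, G.PosSemidef ∧
      (∀ s, block G s s = ((P ∘ₗ append (block W s s)) ^ k) ρ) ∧
      ∀ s t, (block G s t).trace = (block W s t).trace ^ k := by
  induction k with
  -- Both alternatives start in the same state ρ, so all four blocks are ρ and the overlap is 1.
  | zero => exact ⟨ρ.submatrix Prod.snd Prod.snd, hρ.1.submatrix _, fun _ => rfl,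
      fun _ _ => hρ.2.trans (pow_zero _).symm⟩
  | succ k ih =>
    obtain ⟨G, hG, hd, ht⟩ := ih
    refine ⟨amplify (Fin 2) P (blockKronecker G W), hP.1 2 _ (blockKronecker_posSemidef hG hW),
      fun s => ?_, fun s t => ?_⟩
    · rw [pow_succ', Module.End.mul_apply, ← hd]
      rfl
    -- Trace preservation is used on the off-diagonal blocks too, which need not be states; this
    -- makes the overlap exactly multiplicative.
    · change (P (block G s t ⊗ₖ block W s t)).trace = _
      rw [hP.2, Matrix.trace_kronecker, ht, pow_succ]

/-- Indistinguishability: after k rounds the overlap is f ^ k whatever the channel does, so the two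
outputs cannot be further apart than this allows. -/
theorem norm_iterate_sub_iterate_le {A B : Type*} [Fintype A] [Fintype B]
    {P : Matrix (A × B) (A × B) ℂ →ₗ[ℂ] Matrix A A ℂ} (hP : IsChannel P)
    {W : Matrix (Fin 2 × B) (Fin 2 × B) ℂ} (hW : W.PosSemidef)
    (htr : ∀ s, (block W s s).trace = 1) {f : ℝ} (hf : (block W 0 1).trace = f)
    {ρ : Matrix A A ℂ} (hρ : IsDensity ρ) (k : ℕ) (x y : A) :
    ‖((P ∘ₗ append (block W 0 0)) ^ k) ρ x y - ((P ∘ₗ append (block W 1 1)) ^ k) ρ x y‖ ≤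
      2 * √(2 - 2 * f ^ k) := by
  obtain ⟨G, hG, hd, ht⟩ := exists_block_iterate hP hW hρ k
  have re_trace : ∀ s t, ∑ a, (G (s, a) (t, a)).re = (block G s t).trace.re := fun s t =>
    (Complex.re_sum _ _).symm
  rw [← hd, ← hd]
  refine norm_diagBlock_sub_le hG ?_ ?_ ?_ x y
  · rw [re_trace, ht, htr, one_pow, Complex.one_re]
  · rw [re_trace, ht, htr, one_pow, Complex.one_re]
  · rw [re_trace, ht, hf, ← Complex.ofReal_pow, Complex.ofReal_re]

/-- The block matrix whose `(s, t)` block is the tensor product of the `(s, t)` blocks of a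
family. -/
def blockTensorFamily {ι : Type*} [Fintype ι] {X : ι → Type*}
    (W : ∀ i, Matrix (Fin 2 × X i) (Fin 2 × X i) ℂ) :
    Matrix (Fin 2 × ∀ i, X i) (Fin 2 × ∀ i, X i) ℂ :=
  fun p q => ∏ i, W i (p.1, p.2 i) (q.1, q.2 i)

theorem blockTensorFamily_posSemidef {ι : Type*} [Fintype ι] {X : ι → Type*}
    {W : ∀ i, Matrix (Fin 2 × X i) (Fin 2 × X i) ℂ} (hW : ∀ i, (W i).PosSemidef) :
    (blockTensorFamily W).PosSemidef := by
  classical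
  have key : ∀ T : Finset ι, Matrix.PosSemidef
      (fun p q => ∏ i ∈ T, W i (p.1, p.2 i) (q.1, q.2 i) :
        Matrix (Fin 2 × ∀ i, X i) (Fin 2 × ∀ i, X i) ℂ) := by
    intro T
    induction T using Finset.induction_on with
    | empty =>
      have h : (1 : Matrix Unit Unit ℂ).PosSemidef := Matrix.PosSemidef.one
      exact h.submatrix fun _ => ()
    | insert i T hi ih =>
      simp only [Finset.prod_insert hi]
      exact ((hW i).submatrix fun p => (p.1, p.2 i)).hadamard ih
  exact key Finset.univ

theorem trace_tensorFamily {ι : Type*} [Fintype ι] [DecidableEq ι] {X : ι → Type*}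
    [∀ i, Fintype (X i)] (M : ∀ i, Matrix (X i) (X i) ℂ) :
    (tensorFamily M).trace = ∏ i, (M i).trace :=
  (Fintype.prod_sum fun i x => M i x x).symm

theorem block_blockTensorFamily {ι : Type*} [Fintype ι] {X : ι → Type*}
    (W : ∀ i, Matrix (Fin 2 × X i) (Fin 2 × X i) ℂ) (s t : Fin 2) :
    block (blockTensorFamily W) s t = tensorFamily fun i => block (W i) s t :=
  rfl


/-! ### Diagonal Lindbladians -/

/-- The rate of the matrix unit `|x⟩⟨y|` under a Lindbladian with diagonal Hamiltonian `h` and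
diagonal Lindblad operators `d k`. -/
def coherenceRate {A : Type*} {K : ℕ} (h : A → ℂ) (d : Fin K → A → ℂ) (x y : A) : ℂ :=
  -Complex.I * (h x - h y) +
    ∑ k, (d k x * star (d k y) - 1 / 2 * (star (d k x) * d k x + star (d k y) * d k y))

/-- With diagonal Hamiltonian and Lindblad operators every matrix unit is an eigenvector, so the
evolution merely multiplies each entry by a scalar exponential. -/
theorem lindbladian_diagonal_apply {A : Type*} [Fintype A] [DecidableEq A] {K : ℕ} (h : A → ℂ)
    (d : Fin K → A → ℂ) (ρ : Matrix A A ℂ) (x y : A) :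
    lindbladian (Matrix.diagonal h) (fun k => Matrix.diagonal (d k)) ρ x y =
      coherenceRate h d x y * ρ x y := by
  simp only [lindbladian, coherenceRate, LinearMap.coe_mk, AddHom.coe_mk, Matrix.add_apply,
    Matrix.smul_apply, Matrix.sub_apply, Matrix.sum_apply, Matrix.diagonal_conjTranspose,
    Matrix.diagonal_mul_diagonal, Matrix.diagonal_mul, Matrix.mul_diagonal, smul_eq_mul,
    Pi.star_apply, add_mul, Finset.sum_mul]
  congr 1
  · ring
  · exact Finset.sum_congr rfl fun k _ => by ring

theorem evolution_apply_of_entrywise {A : Type*} [Finite A]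
    {𝓛 : Matrix A A ℂ →ₗ[ℂ] Matrix A A ℂ} {r : A → A → ℂ}
    (h : ∀ ρ x y, 𝓛 ρ x y = r x y * ρ x y) (t : ℝ) (ρ : Matrix A A ℂ) (x y : A) :
    evolution 𝓛 t ρ x y = Complex.exp (t * r x y) * ρ x y := by
  have hpow : ∀ k : ℕ, (𝓛 ^ k) ρ x y = r x y ^ k * ρ x y := by
    intro k
    induction k with
    | zero => simp
    | succ k ih => rw [pow_succ', Module.End.mul_apply, h, ih, pow_succ']; ring
  have h1 := (evolution_summable 𝓛 t ρ).hasSum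
  have h2 := Pi.hasSum.mp (Pi.hasSum.mp h1 x) y
  have h3 : HasSum (fun k : ℕ => ((t : ℂ) * r x y) ^ k / (k.factorial : ℂ) * ρ x y)
      (Complex.exp (t * r x y) * ρ x y) := by
    rw [Complex.exp_eq_exp_ℂ]
    exact (NormedSpace.expSeries_div_hasSum_exp ((t : ℂ) * r x y)).mul_right _
  refine (h2.congr_fun fun k => ?_).unique h3
  change _ = (t : ℂ) ^ k / (k.factorial : ℂ) * (𝓛 ^ k) ρ x y
  rw [hpow, mul_pow]
  ring

/-! ### Functions supported on the two constant bit strings -/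

/-- The function with value `a` at `00…0`, `b` at `11…1`, and `0` elsewhere. -/
def twoPoint {I α : Type*} [Fintype I] [Zero α] (a b : α) : Bits I → α :=
  fun x => if x = 0 then a else if x = 1 then b else 0

section TwoPoint

theorem bits_one_ne_zero {I : Type*} [Nonempty I] : (1 : Bits I) ≠ 0 := fun h =>
  one_ne_zero (congrFun h (Classical.arbitrary I))

variable {I α : Type*} [Fintype I]

theorem twoPoint_zero [Zero α] (a b : α) : twoPoint a b (0 : Bits I) = a := if_pos rfl

theorem twoPoint_one [Zero α] [Nonempty I] (a b : α) : twoPoint a b (1 : Bits I) = b := by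
  simp [twoPoint, bits_one_ne_zero]

theorem twoPoint_map {β : Type*} [Zero α] [Zero β] (f : α → β) (hf : f 0 = 0) (a b : α)
    (x : Bits I) : f (twoPoint a b x) = twoPoint (f a) (f b) x := by
  unfold twoPoint
  split_ifs <;> simp [hf]

theorem twoPoint_mul [MulZeroClass α] (a b a' b' : α) (x : Bits I) :
    twoPoint a b x * twoPoint a' b' x = twoPoint (a * a') (b * b') x := by
  unfold twoPoint
  split_ifs <;> simp

theorem sum_twoPoint [AddCommMonoid α] [DecidableEq I] [Nonempty I] (a b : α) :
    ∑ x : Bits I, twoPoint a b x = a + b := by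
  have h : ∀ x : Bits I, twoPoint a b x = (if x = 0 then a else 0) + if x = 1 then b else 0 := by
    intro x
    unfold twoPoint
    split_ifs with h0 h1 <;> simp_all [bits_one_ne_zero]
  simp [h, Finset.sum_add_distrib]

end TwoPoint

/-! ### States with one coherence -/

/-- The state `½(|0⟩⟨0| + |1⟩⟨1| + z|0⟩⟨1| + z̄|1⟩⟨0|)` on the constant bit strings. -/
def coherentState {I : Type*} [Fintype I] (z : ℂ) : Matrix (Bits I) (Bits I) ℂ :=
  fun x y => 1 / 2 * twoPoint (twoPoint 1 z y) (twoPoint (star z) 1 y) x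

theorem coherentState_isDensity {I : Type*} [Fintype I] [DecidableEq I] [Nonempty I] {z : ℂ}
    (hz : ‖z‖ ≤ 1) :
    IsDensity (coherentState z : Matrix (Bits I) (Bits I) ℂ) := by
  constructor
  -- A pure state with the right coherence falls short only by 1 − |z|² in the (1, 1) entry; the
  -- missing weight is nonnegative as |z| ≤ 1.
  · have e : (coherentState z : Matrix (Bits I) (Bits I) ℂ) = (1 / 2 : ℂ) •
        (Matrix.vecMulVec (twoPoint 1 (star z)) (star (twoPoint 1 (star z))) +
          ((1 - ‖z‖ ^ 2 : ℝ) : ℂ) • Matrix.vecMulVec (twoPoint 0 1) (star (twoPoint 0 1))) := by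
      have hn : star z * z = ((‖z‖ ^ 2 : ℝ) : ℂ) := by
        rw [mul_comm, ← starRingEnd_apply, Complex.mul_conj, Complex.normSq_eq_norm_sq]
      ext x y
      simp only [coherentState, Matrix.smul_apply, Matrix.add_apply, Matrix.vecMulVec_apply,
        Pi.star_apply, smul_eq_mul]
      congr 1
      unfold twoPoint
      split_ifs <;> simp_all [bits_one_ne_zero]
    rw [e]
    refine Matrix.PosSemidef.smul (.add (Matrix.posSemidef_vecMulVec_self_star _)
      (Matrix.PosSemidef.smul (Matrix.posSemidef_vecMulVec_self_star _) ?_)) ?_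
    · rw [Complex.zero_le_real, sub_nonneg]
      exact pow_le_one₀ (norm_nonneg z) hz
    · exact one_half_pos.le
  · have h : ∀ x : Bits I, coherentState z x x = twoPoint (1 / 2 : ℂ) (1 / 2) x := by
      intro x
      unfold coherentState twoPoint
      split_ifs <;> simp_all [bits_one_ne_zero]
    simp only [Matrix.trace, Matrix.diag_apply, h, sum_twoPoint]
    norm_num

theorem coherentState_zero_one {I : Type*} [Fintype I] [Nonempty I] (z : ℂ) :
    coherentState z (0 : Bits I) 1 = z / 2 := by
  rw [coherentState, twoPoint_zero, twoPoint_one]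
  ring

/-- Populations are fixed and the two coherences get conjugate factors, so the exact orbit remains
in this one-parameter family. -/
theorem evolution_coherentState {I : Type*} [Fintype I]
    {𝓛 : Matrix (Bits I) (Bits I) ℂ →ₗ[ℂ] Matrix (Bits I) (Bits I) ℂ} {r : Bits I → Bits I → ℂ}
    (h : ∀ ρ x y, 𝓛 ρ x y = r x y * ρ x y) (h00 : r 0 0 = 0) (h11 : r 1 1 = 0)
    (h10 : r 1 0 = star (r 0 1)) (t : ℝ) (z : ℂ) :
    evolution 𝓛 t (coherentState z) = coherentState (Complex.exp (t * r 0 1) * z) := by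
  have hexp : Complex.exp (t * star (r 0 1)) = star (Complex.exp (t * r 0 1)) := by
    rw [← starRingEnd_apply, ← starRingEnd_apply, ← Complex.exp_conj, map_mul, Complex.conj_ofReal]
  ext x y
  rw [evolution_apply_of_entrywise h]
  by_cases hx0 : x = 0
  · subst hx0
    by_cases hy0 : y = 0
    · subst hy0
      simp [coherentState, twoPoint, h00]
    · by_cases hy1 : y = 1
      · subst hy1
        simp only [coherentState, twoPoint, if_true, if_neg hy0]
        ring
      · simp [coherentState, twoPoint, hy0, hy1]
  · by_cases hx1 : x = 1
    · subst hx1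
      by_cases hy0 : y = 0
      · subst hy0
        simp only [coherentState, twoPoint, if_true, if_neg hx0, h10, hexp, star_mul']
        ring
      · by_cases hy1 : y = 1
        · subst hy1
          simp [coherentState, twoPoint, h11, hy0]
        · simp [coherentState, twoPoint, hy0, hy1]
    · simp [coherentState, twoPoint, hx0, hx1]

/-! ### Hamiltonian program states -/

/-- Square roots of the eigenvalues `(1 ∓ g sin φ)/2` of the Hamiltonian program state. -/
def hamAmplitude {I : Type*} [Fintype I] (g φ : ℝ) : Bits I → ℝ :=
  twoPoint ((Real.cos (φ / 2) - g * Real.sin (φ / 2)) / √2)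
    ((Real.cos (φ / 2) + g * Real.sin (φ / 2)) / √2)

/-- The state `(1 - g sin φ)/2 |0⟩⟨0| + (1 + g sin φ)/2 |1⟩⟨1|`, for `g = ±1`. -/
def hamState {I : Type*} [Fintype I] (g φ : ℝ) : Matrix (Bits I) (Bits I) ℂ :=
  Matrix.diagonal fun x => ((hamAmplitude g φ x ^ 2 : ℝ) : ℂ)

/-- Joint block matrix of the states `hamState g (φ s)`. -/
def hamBlock {I : Type*} [Fintype I] (g : ℝ) (φ : Fin 2 → ℝ) :
    Matrix (Fin 2 × Bits I) (Fin 2 × Bits I) ℂ :=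
  fun p q => if p.2 = q.2 then
    ((hamAmplitude g (φ p.1) p.2 * hamAmplitude g (φ q.1) q.2 : ℝ) : ℂ) else 0

theorem hamBlock_posSemidef {I : Type*} [Fintype I] (g : ℝ) (φ : Fin 2 → ℝ) :
    (hamBlock g φ : Matrix (Fin 2 × Bits I) (Fin 2 × Bits I) ℂ).PosSemidef := by
  classical
  have h1 : (1 : Matrix (Bits I) (Bits I) ℂ).PosSemidef := Matrix.PosSemidef.one
  have h := (h1.submatrix (Prod.snd : Fin 2 × Bits I → Bits I)).hadamard
    (Matrix.posSemidef_vecMulVec_self_star fun p : Fin 2 × Bits I =>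
      ((hamAmplitude g (φ p.1) p.2 : ℝ) : ℂ))
  convert! h using 1
  ext p q
  change _ = (1 : Matrix (Bits I) (Bits I) ℂ) p.2 q.2 *
    (((hamAmplitude g (φ p.1) p.2 : ℝ) : ℂ) * star ((hamAmplitude g (φ q.1) q.2 : ℝ) : ℂ))
  simp [hamBlock, Matrix.one_apply]

theorem block_hamBlock_self {I : Type*} [Fintype I] (g : ℝ) (φ : Fin 2 → ℝ) (s : Fin 2) :
    block (hamBlock g φ : Matrix (Fin 2 × Bits I) (Fin 2 × Bits I) ℂ) s s =
      hamState g (φ s) := by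
  ext x y
  simp only [block, hamBlock, hamState, Matrix.diagonal_apply]
  split_ifs with h
  · rw [h, sq]
  · rfl

/-- For g = 1 the amplitudes are the cosine and sine of φ/2 + π/4, and g = −1 swaps them: a unit
vector turning by φ/2. Keeping their signs, rather than taking nonnegative roots, gives this overlap
for all angles. -/
theorem trace_block_hamBlock {I : Type*} [Fintype I] [DecidableEq I] [Nonempty I] {g : ℝ}
    (hg : g ^ 2 = 1)
    (φ : Fin 2 → ℝ) (s t : Fin 2) :
    (block (hamBlock g φ : Matrix (Fin 2 × Bits I) (Fin 2 × Bits I) ℂ) s t).trace =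
      (Real.cos ((φ s - φ t) / 2) : ℝ) := by
  have h : ∀ x : Bits I, block (hamBlock g φ) s t x x =
      ((hamAmplitude g (φ s) x * hamAmplitude g (φ t) x : ℝ) : ℂ) := fun x => if_pos rfl
  simp only [Matrix.trace, Matrix.diag_apply, h, ← Complex.ofReal_sum]
  congr 1
  simp only [hamAmplitude, twoPoint_mul, sum_twoPoint]
  rw [sub_div (φ s), Real.cos_sub]
  have h2 : √(2 : ℝ) * √2 = 2 := Real.mul_self_sqrt (by norm_num)
  rw [div_mul_div_comm, div_mul_div_comm, h2]
  linear_combination Real.sin (φ s / 2) * Real.sin (φ t / 2) * hg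

theorem hamState_isDensity {I : Type*} [Fintype I] [DecidableEq I] [Nonempty I] {g : ℝ}
    (hg : g ^ 2 = 1) (φ : ℝ) :
    IsDensity (hamState g φ : Matrix (Bits I) (Bits I) ℂ) := by
  have h := block_hamBlock_self (I := I) g (fun _ => φ) 0
  refine ⟨Matrix.PosSemidef.diagonal fun x => ?_, ?_⟩
  · exact Complex.zero_le_real.mpr (sq_nonneg _)
  · rw [← h, trace_block_hamBlock hg]
    simp

/-! ### Lindblad program states -/

/-- The diagonal of the Lindblad operator. -/
def lindbladDiag {I : Type*} [Fintype I] (l φ : ℝ) : Bits I → ℂ :=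
  twoPoint ((l / √2 : ℝ) * Complex.exp ((φ / 2 : ℝ) * Complex.I))
    ((l / √2 : ℝ) * Complex.exp (-((φ / 2 : ℝ) * Complex.I)))

theorem star_exp_mul_I (x : ℝ) :
    star (Complex.exp (x * Complex.I)) = Complex.exp (-(x * Complex.I)) := by
  rw [← starRingEnd_apply, ← Complex.exp_conj, map_mul, Complex.conj_ofReal, Complex.conj_I, mul_neg]

theorem star_exp_neg_mul_I (x : ℝ) :
    star (Complex.exp (-(x * Complex.I))) = Complex.exp (x * Complex.I) := by
  rw [← star_exp_mul_I, star_star]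

/-- The Hilbert–Schmidt inner product of two instances is l²/2 times a sum of two conjugate phases.
It yields both the normalisation and the program overlap. -/
theorem sum_lindbladDiag_mul_star {I : Type*} [Fintype I] [DecidableEq I] [Nonempty I]
    (l φ φ' : ℝ) :
    ∑ x : Bits I, lindbladDiag l φ x * star (lindbladDiag l φ' x) =
      ((l ^ 2 * Real.cos ((φ - φ') / 2) : ℝ) : ℂ) := by
  have hs : ∀ x : Bits I, star (lindbladDiag l φ' x) = _ := fun x =>
    twoPoint_map star (star_zero ℂ) _ _ x
  simp only [hs]
  simp only [lindbladDiag, twoPoint_mul, sum_twoPoint, star_mul', star_exp_mul_I,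
    star_exp_neg_mul_I]
  have hr : star ((l / √2 : ℝ) : ℂ) = (l / √2 : ℝ) := Complex.conj_ofReal _
  have h2 : ((l / √2 : ℝ) : ℂ) * (l / √2 : ℝ) = (l ^ 2 : ℝ) / 2 := by
    rw [← Complex.ofReal_mul, div_mul_div_comm, Real.mul_self_sqrt (by norm_num)]
    push_cast
    ring
  rw [hr, Complex.ofReal_mul, Complex.ofReal_cos, Complex.cos]
  have e1 : Complex.exp (((φ - φ') / 2 : ℝ) * Complex.I) =
      Complex.exp ((φ / 2 : ℝ) * Complex.I) * Complex.exp (-((φ' / 2 : ℝ) * Complex.I)) := by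
    rw [← Complex.exp_add]
    congr 1
    push_cast
    ring
  have e2 : Complex.exp (-(((φ - φ') / 2 : ℝ) : ℂ) * Complex.I) =
      Complex.exp (-((φ / 2 : ℝ) * Complex.I)) * Complex.exp ((φ' / 2 : ℝ) * Complex.I) := by
    rw [← Complex.exp_add]
    congr 1
    push_cast
    ring
  rw [e1, e2]
  linear_combination (Complex.exp ((φ / 2 : ℝ) * Complex.I) *
    Complex.exp (-((φ' / 2 : ℝ) * Complex.I)) + Complex.exp (-((φ / 2 : ℝ) * Complex.I)) *
    Complex.exp ((φ' / 2 : ℝ) * Complex.I)) * h2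

theorem hsNorm_lindbladDiag {I : Type*} [Fintype I] [DecidableEq I] [Nonempty I] {l : ℝ}
    (hl : 0 ≤ l) (φ : ℝ) :
    hsNorm (Matrix.diagonal (lindbladDiag l φ) : Matrix (Bits I) (Bits I) ℂ) = l := by
  have h : (Matrix.diagonal (lindbladDiag l φ) *
      (Matrix.diagonal (lindbladDiag l φ))ᴴ : Matrix (Bits I) (Bits I) ℂ).trace = (l ^ 2 : ℝ) := by
    rw [Matrix.diagonal_conjTranspose, Matrix.diagonal_mul_diagonal, Matrix.trace_diagonal]
    exact (sum_lindbladDiag_mul_star l φ φ).trans (by simp)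
  rw [hsNorm, h, Complex.ofReal_re, Real.sqrt_sq hl]

theorem psiVec_apply {A : Type*} [Fintype A] [DecidableEq A] (L : Matrix A A ℂ) (x y : A) :
    psiVec L (x, y) = (hsNorm L : ℂ)⁻¹ * L x y := by
  simp [psiVec, Matrix.mulVec, dotProduct, Fintype.sum_prod_type, gammaVec, Matrix.one_apply]

/-- Joint block matrix of the program states of two Lindblad operators. -/
def psiBlock {A : Type*} [Fintype A] [DecidableEq A] (L : Fin 2 → Matrix A A ℂ) :
    Matrix (Fin 2 × A × A) (Fin 2 × A × A) ℂ :=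
  Matrix.vecMulVec (fun p => psiVec (L p.1) p.2) (star fun p => psiVec (L p.1) p.2)

theorem psiBlock_posSemidef {A : Type*} [Fintype A] [DecidableEq A] (L : Fin 2 → Matrix A A ℂ) :
    (psiBlock L).PosSemidef :=
  Matrix.posSemidef_vecMulVec_self_star _

theorem block_psiBlock_self {A : Type*} [Fintype A] [DecidableEq A] (L : Fin 2 → Matrix A A ℂ)
    (s : Fin 2) : block (psiBlock L) s s = psiState (L s) :=
  rfl

/-- The overlap of program vectors is the normalised Hilbert–Schmidt inner product of the operators.
The phases are chosen so that it equals the Hamiltonian overlap and does not depend on l. -/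
theorem trace_block_psiBlock {I : Type*} [Fintype I] [DecidableEq I] [Nonempty I] {l : ℝ}
    (hl : 0 < l)
    (φ : Fin 2 → ℝ) (s t : Fin 2) :
    (block (psiBlock fun s => (Matrix.diagonal (lindbladDiag l (φ s)) :
      Matrix (Bits I) (Bits I) ℂ)) s t).trace = (Real.cos ((φ s - φ t) / 2) : ℝ) := by
  have hl' : (l : ℂ) ≠ 0 := by exact_mod_cast hl.ne'
  have h : ∀ x y : Bits I,
      block (psiBlock fun s => (Matrix.diagonal (lindbladDiag l (φ s)))) s t (x, y) (x, y) =
        (l : ℂ)⁻¹ ^ 2 * if x = y then lindbladDiag l (φ s) x * star (lindbladDiag l (φ t) x)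
          else 0 := by
    intro x y
    change psiVec (Matrix.diagonal (lindbladDiag l (φ s))) (x, y) *
      star (psiVec (Matrix.diagonal (lindbladDiag l (φ t))) (x, y)) = _
    rw [psiVec_apply, psiVec_apply, hsNorm_lindbladDiag hl.le, hsNorm_lindbladDiag hl.le,
      Matrix.diagonal_apply, Matrix.diagonal_apply]
    split_ifs
    · simp only [← starRingEnd_apply, map_mul, map_inv₀, Complex.conj_ofReal]
      ring
    · simp
  simp only [Matrix.trace, Matrix.diag_apply, Fintype.sum_prod_type, h, ← Finset.mul_sum]
  simp only [Finset.sum_ite_eq, Finset.mem_univ, if_true]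
  rw [sum_lindbladDiag_mul_star]
  push_cast
  field_simp


/-! ### The pair of instances to be distinguished -/

theorem embedLocal_diagonal {N : ℕ} (S : Finset (Fin N)) (f : Bits S → ℂ) :
    embedLocal S (Matrix.diagonal f) = Matrix.diagonal fun x => f fun i => x i := by
  ext x y
  simp only [embedLocal, Matrix.diagonal_apply]
  by_cases h : x = y
  · simp [h]
  · rw [if_neg h]
    split_ifs with h1 h2
    · exact absurd (funext fun i => if hi : i ∈ S then congrFun h2 ⟨i, hi⟩ else h1 i hi) h
    · rfl
    · rfl

theorem coherenceRate_self {A : Type*} {K : ℕ} (h : A → ℂ) (d : Fin K → A → ℂ) (x : A) :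
    coherenceRate h d x x = 0 := by
  rw [coherenceRate, sub_self, mul_zero, zero_add]
  exact Finset.sum_eq_zero fun k _ => by ring

theorem coherenceRate_symm {A : Type*} {K : ℕ} {h : A → ℂ} (hh : ∀ x, star (h x) = h x)
    (d : Fin K → A → ℂ) (x y : A) : coherenceRate h d y x = star (coherenceRate h d x y) := by
  have hI : star Complex.I = -Complex.I := Complex.conj_I
  have h2 : star (1 / 2 : ℂ) = 1 / 2 := by simp
  simp only [coherenceRate, star_add, star_sum, star_mul', star_neg, star_sub, hI, hh, star_star, h2]
  congr 1
  · ring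
  · exact Finset.sum_congr rfl fun k _ => by ring

section Instance

variable {N J K : ℕ}

/-- The sign of a real number, with the convention that zero has sign `1`. -/
def signOne (c : ℝ) : ℝ := if 0 ≤ c then 1 else -1

theorem signOne_sq (c : ℝ) : signOne c ^ 2 = 1 := by
  unfold signOne
  split_ifs <;> norm_num

theorem mul_signOne (c : ℝ) : c * signOne c = |c| := by
  unfold signOne
  split_ifs with h
  · rw [abs_of_nonneg h, mul_one]
  · rw [abs_of_neg (not_le.mp h)]
    ring

/-- The Hamiltonian states of the instance with angle `φ`. -/
def angleStates (c : Fin J → ℝ) (φ : ℝ) (j : Fin J) : Matrix (Bits (Fin N)) (Bits (Fin N)) ℂ :=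
  hamState (signOne (c j)) φ

/-- The Lindblad operators of the instance with angle `φ`. -/
def angleOps (S : Fin K → Finset (Fin N)) (ℓ : Fin K → ℝ) (φ : ℝ) (k : Fin K) :
    Matrix (Bits (S k)) (Bits (S k)) ℂ :=
  Matrix.diagonal (lindbladDiag (ℓ k) φ)

/-- The rates of the Lindbladian of the instance with angle `φ`. -/
def angleRate (c : Fin J → ℝ) (S : Fin K → Finset (Fin N)) (ℓ : Fin K → ℝ) (φ : ℝ) :
    Bits (Fin N) → Bits (Fin N) → ℂ :=
  coherenceRate (fun x => ∑ j, (c j : ℂ) * ((hamAmplitude (signOne (c j)) φ x ^ 2 : ℝ) : ℂ))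
    fun k x => lindbladDiag (ℓ k) φ fun i : S k => x i

theorem targetLindbladian_angle_apply (c : Fin J → ℝ) (S : Fin K → Finset (Fin N)) (ℓ : Fin K → ℝ)
    (φ : ℝ) (ρ : Matrix (Bits (Fin N)) (Bits (Fin N)) ℂ) (x y : Bits (Fin N)) :
    targetLindbladian c (angleStates c φ) (angleOps S ℓ φ) ρ x y =
      angleRate c S ℓ φ x y * ρ x y := by
  have h : ∑ j, (c j : ℂ) • (angleStates c φ j : Matrix (Bits (Fin N)) (Bits (Fin N)) ℂ) =
      Matrix.diagonal fun x =>
        ∑ j, (c j : ℂ) * ((hamAmplitude (signOne (c j)) φ x ^ 2 : ℝ) : ℂ) := by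
    ext x y
    simp only [angleStates, hamState, Matrix.sum_apply, Matrix.smul_apply, Matrix.diagonal_apply,
      smul_eq_mul]
    split_ifs <;> simp
  simp only [targetLindbladian, h, angleOps, embedLocal_diagonal]
  exact lindbladian_diagonal_apply _ _ _ _ _

theorem angleRate_self (c : Fin J → ℝ) (S : Fin K → Finset (Fin N)) (ℓ : Fin K → ℝ)
    (φ : ℝ) (x : Bits (Fin N)) : angleRate c S ℓ φ x x = 0 :=
  coherenceRate_self _ _ _

theorem angleRate_symm (c : Fin J → ℝ) (S : Fin K → Finset (Fin N)) (ℓ : Fin K → ℝ)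
    (φ : ℝ) (x y : Bits (Fin N)) : angleRate c S ℓ φ y x = star (angleRate c S ℓ φ x y) := by
  refine coherenceRate_symm (fun x => ?_) _ _ _
  have h : ∀ r : ℝ, star (r : ℂ) = r := Complex.conj_ofReal
  simp only [star_sum, star_mul', h]

/-- Each Lindblad operator contributes ℓ²/2 · (e^{iφ} − 1): a phase of first order in φ but damping
only of second order. The signs `signOne (c j)` make every Hamiltonian term contribute |c_j| sin φ
with the same sign as these phases, so nothing cancels. Nonemptiness of each S k ensures that 00…0
and 11…1 differ on it. -/
theorem angleRate_zero_one [NeZero N] (c : Fin J → ℝ) {S : Fin K → Finset (Fin N)}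
    (hS : ∀ k, (S k).Nonempty) (ℓ : Fin K → ℝ) (φ : ℝ) :
    angleRate c S ℓ φ 0 1 = ((-((∑ k, ℓ k ^ 2) / 2 * (1 - Real.cos φ)) : ℝ) : ℂ) +
      ((Real.sin φ * (∑ j, |c j| + (∑ k, ℓ k ^ 2) / 2) : ℝ) : ℂ) * Complex.I := by
  have hham : ∀ j, (c j : ℂ) * ((hamAmplitude (signOne (c j)) φ (0 : Bits (Fin N)) ^ 2 : ℝ) : ℂ) -
      (c j : ℂ) * ((hamAmplitude (signOne (c j)) φ (1 : Bits (Fin N)) ^ 2 : ℝ) : ℂ) =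
      ((-(|c j| * Real.sin φ) : ℝ) : ℂ) := by
    intro j
    rw [← Complex.ofReal_mul, ← Complex.ofReal_mul, ← Complex.ofReal_sub]
    congr 1
    rw [hamAmplitude, twoPoint_zero, twoPoint_one, div_pow, div_pow, Real.sq_sqrt (by norm_num),
      ← mul_signOne]
    have h := Real.sin_two_mul (φ / 2)
    rw [mul_div_cancel₀ φ two_ne_zero] at h
    rw [h]
    ring
  have hlind : ∀ k, lindbladDiag (ℓ k) φ (fun i : S k => (0 : Bits (Fin N)) i) *
        star (lindbladDiag (ℓ k) φ (fun i : S k => (1 : Bits (Fin N)) i)) -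
      1 / 2 * (star (lindbladDiag (ℓ k) φ (fun i : S k => (0 : Bits (Fin N)) i)) *
          lindbladDiag (ℓ k) φ (fun i : S k => (0 : Bits (Fin N)) i) +
        star (lindbladDiag (ℓ k) φ (fun i : S k => (1 : Bits (Fin N)) i)) *
          lindbladDiag (ℓ k) φ (fun i : S k => (1 : Bits (Fin N)) i)) =
      ((ℓ k ^ 2 / 2 : ℝ) : ℂ) * (Real.cos φ + Real.sin φ * Complex.I - 1) := by
    intro k
    have : Nonempty (S k) := (hS k).to_subtype
    have e0 : lindbladDiag (ℓ k) φ (fun i : S k => (0 : Bits (Fin N)) i) =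
        (ℓ k / √2 : ℝ) * Complex.exp ((φ / 2 : ℝ) * Complex.I) := twoPoint_zero _ _
    have e1 : lindbladDiag (ℓ k) φ (fun i : S k => (1 : Bits (Fin N)) i) =
        (ℓ k / √2 : ℝ) * Complex.exp (-((φ / 2 : ℝ) * Complex.I)) := twoPoint_one _ _
    have hr : star ((ℓ k / √2 : ℝ) : ℂ) = (ℓ k / √2 : ℝ) := Complex.conj_ofReal _
    have h2 : ((ℓ k / √2 : ℝ) : ℂ) * (ℓ k / √2 : ℝ) = (ℓ k ^ 2 / 2 : ℝ) := by
      rw [← Complex.ofReal_mul, div_mul_div_comm, Real.mul_self_sqrt (by norm_num), sq]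
    have h3 : Complex.exp ((φ / 2 : ℝ) * Complex.I) * Complex.exp ((φ / 2 : ℝ) * Complex.I) =
        Real.cos φ + Real.sin φ * Complex.I := by
      rw [← Complex.exp_add, ← add_mul, ← Complex.ofReal_add, add_halves, Complex.exp_mul_I,
        Complex.ofReal_cos, Complex.ofReal_sin]
    have h4 : Complex.exp ((φ / 2 : ℝ) * Complex.I) * Complex.exp (-((φ / 2 : ℝ) * Complex.I)) =
        1 := by
      rw [← Complex.exp_add, add_neg_cancel, Complex.exp_zero]
    rw [e0, e1, star_mul', star_mul', star_exp_mul_I, star_exp_neg_mul_I, hr, ← h2, ← h3]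
    linear_combination (-((ℓ k / √2 : ℝ) : ℂ) * (ℓ k / √2 : ℝ)) * h4
  rw [angleRate, coherenceRate, ← Finset.sum_sub_distrib]
  simp only [hham, hlind]
  push_cast
  rw [← Finset.sum_mul, Finset.sum_neg_distrib, ← Finset.sum_mul, ← Finset.sum_div]
  ring

/-- Joint block matrix of the program states of the instances with angles `φ 0` and `φ 1`. -/
def angleBlock (c : Fin J → ℝ) (S : Fin K → Finset (Fin N)) (ℓ : Fin K → ℝ) (n : Fin J → ℕ)
    (m : Fin K → ℕ) (φ : Fin 2 → ℝ) :
    Matrix (Fin 2 × ProgramIdx S n m) (Fin 2 × ProgramIdx S n m) ℂ :=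
  blockKronecker
    (blockTensorFamily fun p : Σ j : Fin J, Fin (n j) => hamBlock (signOne (c p.1)) φ)
    (blockTensorFamily fun p : Σ k : Fin K, Fin (m k) =>
      psiBlock fun s => angleOps S ℓ (φ s) p.1)

theorem angleBlock_posSemidef (c : Fin J → ℝ) (S : Fin K → Finset (Fin N)) (ℓ : Fin K → ℝ)
    (n : Fin J → ℕ) (m : Fin K → ℕ) (φ : Fin 2 → ℝ) :
    (angleBlock c S ℓ n m φ).PosSemidef :=
  blockKronecker_posSemidef (blockTensorFamily_posSemidef fun _ => hamBlock_posSemidef _ _)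
    (blockTensorFamily_posSemidef fun _ => psiBlock_posSemidef _)

theorem block_angleBlock_self (c : Fin J → ℝ) (S : Fin K → Finset (Fin N)) (ℓ : Fin K → ℝ)
    (n : Fin J → ℕ) (m : Fin K → ℕ) (φ : Fin 2 → ℝ) (s : Fin 2) :
    block (angleBlock c S ℓ n m φ) s s =
      programState n m (angleStates c (φ s)) (angleOps S ℓ (φ s)) := by
  rw [angleBlock, block_blockKronecker, block_blockTensorFamily, block_blockTensorFamily]
  simp only [block_hamBlock_self, block_psiBlock_self]
  rfl

theorem trace_block_angleBlock [NeZero N] (c : Fin J → ℝ) {S : Fin K → Finset (Fin N)}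
    (hS : ∀ k, (S k).Nonempty) {ℓ : Fin K → ℝ} (hℓ : ∀ k, 0 < ℓ k)
    (n : Fin J → ℕ) (m : Fin K → ℕ) (φ : Fin 2 → ℝ) (s t : Fin 2) :
    (block (angleBlock c S ℓ n m φ) s t).trace =
      ((Real.cos ((φ s - φ t) / 2) ^ (∑ j, n j + ∑ k, m k) : ℝ) : ℂ) := by
  rw [angleBlock, block_blockKronecker, block_blockTensorFamily, block_blockTensorFamily,
    Matrix.trace_kronecker, trace_tensorFamily, trace_tensorFamily]
  have h : ∀ p : Σ k : Fin K, Fin (m k),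
      (block (psiBlock fun s => angleOps S ℓ (φ s) p.1) s t).trace =
        (Real.cos ((φ s - φ t) / 2) : ℝ) := fun p =>
    have : Nonempty (S p.1) := (hS p.1).to_subtype
    trace_block_psiBlock (hℓ p.1) φ s t
  simp only [h, trace_block_hamBlock (signOne_sq _), Finset.prod_const, Finset.card_univ,
    Fintype.card_sigma, Fintype.card_fin]
  rw [← pow_add, Complex.ofReal_pow]

theorem angleStates_isDensity [NeZero N] (c : Fin J → ℝ) (φ : ℝ) (j : Fin J) :
    IsDensity (angleStates c φ j : Matrix (Bits (Fin N)) (Bits (Fin N)) ℂ) :=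
  hamState_isDensity (signOne_sq _) _

theorem hsNorm_angleOps {S : Fin K → Finset (Fin N)} (hS : ∀ k, (S k).Nonempty) {ℓ : Fin K → ℝ}
    (hℓ : ∀ k, 0 < ℓ k) (φ : ℝ) (k : Fin K) : hsNorm (angleOps S ℓ φ k) = ℓ k :=
  have : Nonempty (S k) := (hS k).to_subtype
  hsNorm_lindbladDiag (hℓ k).le φ

/-- Iterating a simulation protocol `k` times on the instance with angle `φ` produces the
coherence of the evolution for time `k t`, up to `2 k ε`. -/
theorem norm_iterate_sub_le [NeZero N] {c : Fin J → ℝ} {S : Fin K → Finset (Fin N)}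
    (hS : ∀ k, (S k).Nonempty) {ℓ : Fin K → ℝ} (hℓ : ∀ k, 0 < ℓ k) {t ε : ℝ} (ht : 0 ≤ t)
    (hε : 0 ≤ ε) {n : Fin J → ℕ} {m : Fin K → ℕ}
    {P : Matrix (Bits (Fin N) × ProgramIdx S n m) (Bits (Fin N) × ProgramIdx S n m) ℂ →ₗ[ℂ]
      Matrix (Bits (Fin N)) (Bits (Fin N)) ℂ}
    (hP : IsChannel P) (hsim : Simulates c S ℓ t ε n m P) (φ : ℝ) (k : ℕ) :
    ‖((P ∘ₗ append (programState n m (angleStates c φ) (angleOps S ℓ φ))) ^ k)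
        (coherentState 1) 0 1 - Complex.exp (t * angleRate c S ℓ φ 0 1) ^ k / 2‖ ≤
      k * (2 * ε) := by
  set π := programState n m (angleStates c φ) (angleOps S ℓ φ) with hπ
  set μ := Complex.exp (t * angleRate c S ℓ φ 0 1) with hμ
  have hπ' := block_angleBlock_self c S ℓ n m (fun _ => φ) 0
  have hπp : π.PosSemidef := by
    rw [hπ, ← hπ']
    exact (angleBlock_posSemidef c S ℓ n m fun _ => φ).submatrix fun b => (0, b)
  have hπt : π.trace = 1 := by
    rw [hπ, ← hπ', trace_block_angleBlock c hS hℓ]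
    simp
  have hpos : ∀ Y : Matrix (Bits (Fin N)) (Bits (Fin N)) ℂ, Y.PosSemidef →
      ((P ∘ₗ append π) Y).PosSemidef := fun Y hY =>
    hP.map_posSemidef (append_posSemidef hπp hY)
  have htr : ∀ Y : Matrix (Bits (Fin N)) (Bits (Fin N)) ℂ,
      ((P ∘ₗ append π) Y).trace = Y.trace := fun Y => by
    rw [LinearMap.comp_apply, hP.2, trace_append, hπt, mul_one]
  -- Needed for `coherentState (μ ^ j)` to be a density operator at every step, so that the
  -- diamond-norm bound applies along the whole exact orbit.
  have hμ1 : ‖μ‖ ≤ 1 := by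
    rw [hμ, Complex.norm_exp, angleRate_zero_one c hS, Real.exp_le_one_iff, Complex.re_ofReal_mul]
    refine mul_nonpos_of_nonneg_of_nonpos ht ?_
    simp only [Complex.add_re, Complex.ofReal_re, Complex.re_ofReal_mul, Complex.I_re, mul_zero,
      add_zero, Left.neg_nonpos_iff]
    have h1 : 0 ≤ ∑ k, ℓ k ^ 2 := Finset.sum_nonneg fun _ _ => sq_nonneg _
    have h2 := Real.cos_le_one φ
    exact mul_nonneg (by positivity) (by linarith)
  have hdens : ∀ j : ℕ, IsDensity
      (coherentState (μ ^ j) : Matrix (Bits (Fin N)) (Bits (Fin N)) ℂ) := fun j =>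
    coherentState_isDensity (by rw [norm_pow]; exact pow_le_one₀ (norm_nonneg _) hμ1)
  have hE : ∀ j : ℕ, evolution (targetLindbladian c (angleStates c φ) (angleOps S ℓ φ)) t
      (coherentState (μ ^ j)) = coherentState (μ ^ (j + 1)) := fun j => by
    rw [evolution_coherentState (targetLindbladian_angle_apply c S ℓ φ) (angleRate_self ..)
      (angleRate_self ..) (angleRate_symm ..), pow_succ']
  have hdiam := hsim (angleStates c φ) (angleOps S ℓ φ) (angleStates_isDensity c φ)
    (hsNorm_angleOps hS hℓ φ)
  have h := decompBound_iterate hpos htr hE (fun j => decompBound_of_diamondNorm_le hε hdiam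
    (hdens j) (by
      rw [LinearMap.sub_apply, hE]
      exact (hpos _ (hdens j).1).1.sub (hdens (j + 1)).1.1)) k
  have h' := h.norm_entry_le 0 1
  rwa [pow_zero, Matrix.sub_apply, coherentState_zero_one] at h'

/-- The trade-off between simulation error and distinguishability. -/
theorem exp_mul_abs_sin_le [NeZero N] {c : Fin J → ℝ} {S : Fin K → Finset (Fin N)}
    (hS : ∀ k, (S k).Nonempty) {ℓ : Fin K → ℝ} (hℓ : ∀ k, 0 < ℓ k) {t ε : ℝ} (ht : 0 ≤ t)
    (hε : 0 ≤ ε) {n : Fin J → ℕ} {m : Fin K → ℕ}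
    {P : Matrix (Bits (Fin N) × ProgramIdx S n m) (Bits (Fin N) × ProgramIdx S n m) ℂ →ₗ[ℂ]
      Matrix (Bits (Fin N)) (Bits (Fin N)) ℂ}
    (hP : IsChannel P) (hsim : Simulates c S ℓ t ε n m P) (φ : ℝ) (k : ℕ) :
    Real.exp (-(k * t * ((∑ k, ℓ k ^ 2) / 2 * (1 - Real.cos φ)))) *
        |Real.sin (k * t * (Real.sin φ * (∑ j, |c j| + (∑ k, ℓ k ^ 2) / 2)))| ≤
      4 * k * ε + 2 * √(2 - 2 * Real.cos φ ^ ((∑ j, n j + ∑ k, m k) * k)) := by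
  set R := (∑ k, ℓ k ^ 2) / 2 * (1 - Real.cos φ)
  set B := ∑ j, |c j| + (∑ k, ℓ k ^ 2) / 2
  -- With opposite angles the damping (even in φ) is common and the phase (odd in φ) flips sign, so
  -- the ideal coherences differ exactly by an exponential times a sine. The half-difference of the
  -- angles is φ, whence the overlap cos φ per copy.
  let ang : Fin 2 → ℝ := ![φ, -φ]
  have hd := norm_iterate_sub_iterate_le hP (angleBlock_posSemidef c S ℓ n m ang)
    (fun s => by rw [trace_block_angleBlock c hS hℓ]; simp)
    (trace_block_angleBlock c hS hℓ n m ang 0 1)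
    (coherentState_isDensity (I := Fin N) (z := 1) (by simp)) k 0 1
  rw [block_angleBlock_self, block_angleBlock_self, ← pow_mul,
    show (ang 0 - ang 1) / 2 = φ by simp [ang]] at hd
  have h0 := norm_iterate_sub_le hS hℓ ht hε hP hsim φ k
  have h1 := norm_iterate_sub_le hS hℓ ht hε hP hsim (-φ) k
  rw [show ang 0 = φ from rfl, show ang 1 = -φ from rfl] at hd
  have hμ : ∀ s : ℝ, Complex.exp (t * (((-R : ℝ) : ℂ) + (s : ℝ) * Complex.I)) ^ k =
      (Real.exp (-(k * t * R)) : ℝ) * (Real.cos (k * t * s) + Real.sin (k * t * s) * Complex.I) := by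
    intro s
    rw [← Complex.exp_nat_mul, Complex.ofReal_exp, Complex.ofReal_cos, Complex.ofReal_sin,
      ← Complex.exp_mul_I, ← Complex.exp_add]
    congr 1
    push_cast
    ring
  have hdiff : ‖Complex.exp (t * angleRate c S ℓ φ 0 1) ^ k / 2 -
      Complex.exp (t * angleRate c S ℓ (-φ) 0 1) ^ k / 2‖ =
      Real.exp (-(k * t * R)) * |Real.sin (k * t * (Real.sin φ * B))| := by
    rw [angleRate_zero_one c hS, angleRate_zero_one c hS, Real.cos_neg, Real.sin_neg, hμ, hμ,
      neg_mul, mul_neg, Real.cos_neg, Real.sin_neg]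
    have e : ∀ a b d : ℝ, (a : ℂ) * (b + d * Complex.I) / 2 -
        a * (b + (-d : ℝ) * Complex.I) / 2 = (a * d : ℝ) * Complex.I := by
      intro a b d
      push_cast
      ring
    rw [e, norm_mul, Complex.norm_I, mul_one, Complex.norm_real, Real.norm_eq_abs, abs_mul,
      Real.abs_exp]
  rw [← hdiff]
  set u := Complex.exp (t * angleRate c S ℓ φ 0 1) ^ k / 2
  set v := Complex.exp (t * angleRate c S ℓ (-φ) 0 1) ^ k / 2
  generalize ((P ∘ₗ append (programState n m (angleStates c φ) (angleOps S ℓ φ))) ^ k)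
    (coherentState 1) 0 1 = a at h0 hd
  generalize ((P ∘ₗ append (programState n m (angleStates c (-φ)) (angleOps S ℓ (-φ)))) ^ k)
    (coherentState 1) 0 1 = b at h1 hd
  rw [norm_sub_rev] at h0
  have e : u - v = (u - a) + (a - b) + (b - v) := by ring
  rw [e]
  refine (norm_add₃_le).trans ?_
  linarith

end Instance

/-- Extracting the number of copies from the trade-off at angle `φ = 1 / (B T)`. -/
theorem copies_lower_bound {B T Λ δ : ℝ} {M : ℕ} (hBT : 2 ≤ B * T) (hT : 0 ≤ T)
    (hΛ : Λ / 2 ≤ B) (hδ : δ ≤ 1 / 10)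
    (h : Real.exp (-(T * (Λ / 2 * (1 - Real.cos (1 / (B * T)))))) *
        |Real.sin (T * (Real.sin (1 / (B * T)) * B))| ≤
      δ + 2 * √(2 - 2 * Real.cos (1 / (B * T)) ^ M)) :
    (B * T) ^ 2 / 25 ≤ M := by
  set φ := 1 / (B * T) with hφ
  have hBT0 : 0 < B * T := by linarith
  have hφ0 : 0 < φ := by positivity
  have hφB : φ * (B * T) = 1 := one_div_mul_cancel hBT0.ne'
  have hφ2 : φ ≤ 1 / 2 := one_div_le_one_div_of_le (by norm_num) hBT
  have hcos := Real.one_sub_sq_div_two_le_cos (x := φ)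
  have hcos1 := Real.cos_le_one φ
  have hsq : φ ^ 2 ≤ 1 / 4 := by nlinarith
  -- Since Λ/2 ≤ B and 1 − cos φ ≤ φ²/2, the total damping exponent is at most BTφ²/2 = φ/2 ≤ 1/4.
  have hexp : 3 / 4 ≤ Real.exp (-(T * (Λ / 2 * (1 - Real.cos φ)))) := by
    have h1 : T * (Λ / 2 * (1 - Real.cos φ)) ≤ T * (B * (φ ^ 2 / 2)) := by
      have hB : 0 ≤ B := by
        by_contra hB
        nlinarith
      refine mul_le_mul_of_nonneg_left ?_ hT
      exact (mul_le_mul_of_nonneg_right hΛ (by linarith)).trans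
        (mul_le_mul_of_nonneg_left (by linarith) hB)
    have h2 : T * (B * (φ ^ 2 / 2)) = φ / 2 := by linear_combination φ / 2 * hφB
    have h3 := Real.add_one_le_exp (-(T * (Λ / 2 * (1 - Real.cos φ))))
    linarith
  -- The phase x is close to BTφ = 1: the cubic sine bound gives 23/24 ≤ x ≤ 1, and the same bound
  -- at x gives sin x ≥ 23/24 − 1/6.
  have hsin : 3 / 4 ≤ |Real.sin (T * (Real.sin φ * B))| := by
    set x := T * (Real.sin φ * B) with hx
    have h1 := Real.sin_gt_sub_cube hφ0
    have h2 := Real.sin_le hφ0.le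
    have hx1 : x ≤ 1 := by
      have := mul_le_mul_of_nonneg_right h2 hBT0.le
      linarith
    have hx2 : 23 / 24 ≤ x := by
      have := mul_le_mul_of_nonneg_right h1.le hBT0.le
      have e : (φ - φ ^ 3 / 6) * (B * T) = 1 - φ ^ 2 / 6 := by
        linear_combination (1 - φ ^ 2 / 6) * hφB
      linarith
    have h3 := Real.sin_gt_sub_cube (x := x) (by linarith)
    have h4 : x ^ 3 ≤ 1 := pow_le_one₀ (by linarith) hx1
    exact le_trans (by linarith) (le_abs_self _)
  have hprod : 9 / 16 ≤ Real.exp (-(T * (Λ / 2 * (1 - Real.cos φ)))) *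
      |Real.sin (T * (Real.sin φ * B))| := by
    nlinarith
  -- 9/16 − 1/10 exceeds 2/5, which is twice the claimed bound.
  have hroot : 1 / 5 ≤ √(2 - 2 * Real.cos φ ^ M) := by linarith
  have hF : 1 / 25 ≤ 2 - 2 * Real.cos φ ^ M := by
    have := (Real.le_sqrt' (by norm_num)).mp hroot
    linarith
  -- Bernoulli's inequality turns the overlap into the count: 2 − 2 cos φ ^ M ≤ M φ².
  have hbern : 1 + (M : ℝ) * (-(φ ^ 2 / 2)) ≤ Real.cos φ ^ M :=
    (one_add_mul_le_pow (by linarith) M).trans (pow_le_pow_left₀ (by linarith) (by linarith) M)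
  have hM : 1 / 25 ≤ M * φ ^ 2 := by linarith
  calc (B * T) ^ 2 / 25 = 1 / 25 * (B * T) ^ 2 := by ring
    _ ≤ M * φ ^ 2 * (B * T) ^ 2 := by gcongr
    _ = M * (φ * (B * T)) ^ 2 := by ring
    _ = M := by rw [hφB]; ring

end

end SampleSim

theorem theorem5 :
    ∃ κ : ℝ, 0 < κ ∧ ∃ a : ℝ, 0 < a ∧
      ∀ (N J K : ℕ), 1 ≤ N →
      ∀ (c : Fin J → ℝ) (S : Fin K → Finset (Fin N)) (ℓ : Fin K → ℝ),
        (∀ k, (S k).Nonempty) → (∀ k, 0 < ℓ k) →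
      ∀ (C : ℝ), C = ∑ j, |c j| + ∑ k, ℓ k ^ 2 →
      ∀ (t ε : ℝ), 0 ≤ t → 0 < ε → ε ≤ a * min 1 (C * t) →
      ∀ (n : Fin J → ℕ) (m : Fin K → ℕ)
        (P : Matrix (SampleSim.Bits (Fin N) × SampleSim.ProgramIdx S n m)
            (SampleSim.Bits (Fin N) × SampleSim.ProgramIdx S n m) ℂ →ₗ[ℂ]
          Matrix (SampleSim.Bits (Fin N)) (SampleSim.Bits (Fin N)) ℂ),
        SampleSim.IsChannel P → SampleSim.Simulates c S ℓ t ε n m P →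
          κ * (C ^ 2 * t ^ 2 / ε) ≤ ∑ j, (n j : ℝ) + ∑ k, (m k : ℝ) := by
  -- The bound a = 1/320 gives Ckt ≥ 320kε ≥ 4, hence B·kt ≥ 2; κ = 1/8000 is 1/100 (from (C/2)²/25)
  -- times the 1/80 in k ≥ 1/(80ε).
  refine ⟨1 / 8000, by norm_num, 1 / 320, by norm_num, ?_⟩
  intro N J K hN c S ℓ hS hℓ C hC t ε ht hε hεa n m P hP hsim
  have : NeZero N := ⟨by omega⟩
  have hε1 : ε ≤ 1 / 320 := by linarith [min_le_left 1 (C * t)]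
  have hεC : ε ≤ 1 / 320 * (C * t) := by linarith [min_le_right 1 (C * t)]
  -- The most repetitions for which the accumulated error 4kε of the two instances stays within
  -- 1/10; smallness of ε makes rounding down cost at most a factor 2.
  set k := ⌊1 / (40 * ε)⌋₊
  have hk1 : (k : ℝ) ≤ 1 / (40 * ε) := Nat.floor_le (by positivity)
  have hk2 : 1 / (80 * ε) ≤ (k : ℝ) := by
    have h1 : 1 / (40 * ε) < k + 1 := Nat.lt_floor_add_one _
    have h2 : 1 / (40 * ε) = 2 * (1 / (80 * ε)) := by
      field_simp
      norm_num
    have h3 : 1 ≤ 1 / (80 * ε) := by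
      rw [le_div_iff₀ (by positivity)]
      linarith
    linarith
  have hkε : 4 * k * ε ≤ 1 / 10 := by
    rw [le_div_iff₀ (by positivity)] at hk1
    linarith
  have hkε' : 1 ≤ 80 * (k * ε) := by
    rw [div_le_iff₀ (by positivity)] at hk2
    linarith
  have hk0 : 0 < (k : ℝ) := lt_of_lt_of_le (by positivity) hk2
  have hΛ : 0 ≤ ∑ k, ℓ k ^ 2 := Finset.sum_nonneg fun _ _ => sq_nonneg _
  have hc : 0 ≤ ∑ j, |c j| := Finset.sum_nonneg fun _ _ => abs_nonneg _
  set Λ := ∑ k, ℓ k ^ 2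
  set B := ∑ j, |c j| + Λ / 2 with hB
  have hBC : C / 2 ≤ B := by linarith
  have hCkt : 4 ≤ C * (k * t) := by
    have := mul_le_mul_of_nonneg_left hεC hk0.le
    linarith
  have hBkt : C * (k * t) / 2 ≤ B * (k * t) := by
    have := mul_le_mul_of_nonneg_right hBC (mul_nonneg hk0.le ht)
    linarith
  have hM := SampleSim.copies_lower_bound (T := k * t) (by linarith) (mul_nonneg hk0.le ht)
    (show Λ / 2 ≤ B by linarith) hkε
    (SampleSim.exp_mul_abs_sin_le hS hℓ ht hε.le hP hsim (1 / (B * (k * t))) k)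
  have hsq : (C * (k * t) / 2) ^ 2 ≤ (B * (k * t)) ^ 2 := by
    gcongr
  push_cast at hM
  set M : ℝ := ∑ j, (n j : ℝ) + ∑ k, (m k : ℝ)
  -- The k runs consume M·k copies, so one of the two factors k in (Ckt)² cancels and the other, of
  -- order 1/ε, remains.
  have hM' : C ^ 2 * t ^ 2 * k / 100 ≤ M := by
    refine le_of_mul_le_mul_right ?_ hk0
    linarith
  calc 1 / 8000 * (C ^ 2 * t ^ 2 / ε) = C ^ 2 * t ^ 2 / 100 * (1 / (80 * ε)) := by
        field_simp
        ring
    _ ≤ C ^ 2 * t ^ 2 / 100 * k := by gcongr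
    _ ≤ M := by linarith
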